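/- For $P,Q\in\mathbb{C}[t]$ let $x_1,\dots,x_r$ and $y_1,\dots,y_s$ be the complex zeros of $P$ and of $Q$, listed with multiplicity. If $P$ and $Q$ have no common zero, let $$\mathrm{PER}(P(x),Q(y))=\mathrm{per}\left(\frac{1}{x_i-y_j}\right)_{1\le i\le r,\ 1\le j\le s},$$ where the permanent of an $r\times s$ matrix $A$ is $\sum_f\prod_{i=1}^r A_{i,f(i)}$, the sum running over all injections $f:\{1,\dots,r\}\to\{1,\dots,s\}$. Write $(\alpha)_k=\alpha(\alpha+1)\cdots(\alpha+k-1)$ for $k\ge 1$ and $(\alpha)_0=1$. Let $n$ and $m$ be positive integers with $n\ge 2$, and let $a$ be an arbitrary complex number. Then the polynomials $x^{n-1}+\cdots+x+1$ and $\sum_{\ell=0}^{mn-1}(\ell+a)y^{\ell}$ have no common zero, and $$\mathrm{PER}\left(x^{n-1}+\cdots+x+1,\ \sum_{\ell=0}^{mn-1}(\ell+a)y^{\ell}\right)=(-1)^{n-1}\bigl(a+(m-1)n+1\bigr)_{n-1}.$$ -/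

import Mathlib

open Polynomial

noncomputable section

/-- The permanent of a rectangular matrix: the sum, over all ways to choose one entry in every row
with no two chosen entries in the same column, of the product of the chosen entries. -/
def rectPermanent {ι κ R : Type*} [Fintype ι] [Fintype κ] [CommSemiring R]
    (A : Matrix ι κ R) : R :=
  open scoped Classical in ∑ f : ι ↪ κ, ∏ i, A i (f i)

/-- The matrix `(1 / (x_i - y_j))` whose rows are indexed by the complex zeros `x_i` of `P` and
whose columns are indexed by the complex zeros `y_j` of `Q`, each zero being listed as often as its
multiplicity. (The coercion of the multiset `P.roots` to a type has one element for every
occurrence of a root, and the first component of that element is the root.) -/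
def scottMatrix (P Q : ℂ[X]) : Matrix P.roots Q.roots ℂ :=
  Matrix.of fun x y => 1 / (x.1 - y.1)

/-- The Scott-type permanent `PER(P(x), Q(y))`. -/
def scottPER (P Q : ℂ[X]) : ℂ := rectPermanent (scottMatrix P Q)

end

/-! Give each column a complex multiplicity, a falling factorial counting its uses; multiplicity 1
recovers the permanent. Expanding along a row and using partial fractions yields a recursion that
sees the columns only through the row sums `∑ α j / (x i - y j)`, so columns may be exchanged freely
if these sums persist (`weightedCauchyPermanent_congr`). For the zeros of `Q` the row sum is `Q'/Q`.
With `N = m * n`, at a nontrivial `n`-th root of unity it equals `(a + N)/x - 2/(x - 1)`. So two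
columns suffice: `0` with multiplicity `a + N` and `1` with multiplicity `-2`. That permanent is a
Vandermonde convolution. -/

open Finset in
/-- Sum over all assignments of columns `j : J` to the rows `i : ι` of products of the entries
`1 / (x i - y j)`, where the column `j` has a complex multiplicity `α j`: using it `k` times
contributes the falling factorial `α j * (α j - 1) * ⋯ * (α j - k + 1)`. -/
noncomputable def weightedCauchyPermanent {ι J : Type*} [Fintype ι] [DecidableEq ι] [Fintype J]
    [DecidableEq J] (α y : J → ℂ) (x : ι → ℂ) : ℂ :=
  ∑ g : ι → J, (∏ j, (descPochhammer ℂ (#{i | g i = j})).eval (α j)) *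
    ∏ i, 1 / (x i - y (g i))

lemma prod_descPochhammer_card_fiber_cons {J : Type*} [Fintype J] [DecidableEq J] (α : J → ℂ)
    {r : ℕ} (j₀ : J) (g : Fin r → J) :
    ∏ j, (descPochhammer ℂ (Finset.card {i | (Fin.cons j₀ g : Fin (r + 1) → J) i = j})).eval (α j) =
      (∏ j, (descPochhammer ℂ (Finset.card {i | g i = j})).eval (α j)) *
        (α j₀ - Finset.card {i | g i = j₀}) := by
  have h (j : J) : Finset.card {i | (Fin.cons j₀ g : Fin (r + 1) → J) i = j} =
      (if j₀ = j then 1 else 0) + Finset.card {i | g i = j} := by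
    simp only [Finset.card_filter, Fin.sum_univ_succ, Fin.cons_zero, Fin.cons_succ]
  rw [← Finset.mul_prod_erase _ _ (Finset.mem_univ j₀),
    ← Finset.mul_prod_erase _ (fun j => (descPochhammer ℂ (Finset.card {i | g i = j})).eval (α j))
      (Finset.mem_univ j₀), h, if_pos rfl, add_comm 1, descPochhammer_succ_eval]
  rw [Finset.prod_congr rfl fun j hj => by
    rw [h, if_neg (Finset.ne_of_mem_erase hj).symm, zero_add]]
  ring

/-- Expansion of the weighted permanent along its first row. -/
lemma weightedCauchyPermanent_cons {J : Type*} [Fintype J] [DecidableEq J] (α y : J → ℂ)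
    {r : ℕ} (x₀ : ℂ) (x : Fin r → ℂ) (hx : ∀ i, x₀ ≠ x i) (hy₀ : ∀ j, x₀ ≠ y j)
    (hy : ∀ i j, x i ≠ y j) :
    weightedCauchyPermanent α y (Fin.cons x₀ x : Fin (r + 1) → ℂ) =
      (∑ j, α j / (x₀ - y j)) * weightedCauchyPermanent α y x -
        ∑ i, (weightedCauchyPermanent α y x -
          weightedCauchyPermanent α y (Function.update x i x₀)) / (x₀ - x i) := by
  unfold weightedCauchyPermanent
  rw [← (Fin.consEquiv fun _ => J).sum_comp, Fintype.sum_prod_type, Finset.sum_comm]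
  simp only [← Finset.sum_sub_distrib, Finset.sum_div, Finset.mul_sum]
  rw [Finset.sum_comm (s := Finset.univ (α := Fin r)), ← Finset.sum_sub_distrib]
  refine Finset.sum_congr rfl fun g _ => ?_
  simp only [Fin.consEquiv_apply, prod_descPochhammer_card_fiber_cons, Fin.prod_univ_succ,
    Fin.cons_zero, Fin.cons_succ]
  set W := ∏ j, (descPochhammer ℂ (Finset.card {i | g i = j})).eval (α j)
  set p := ∏ i, 1 / (x i - y (g i)) with hp
  -- Partial fractions: `1/(x i - y) - 1/(x₀ - y) = (x₀ - x i) / ((x i - y) * (x₀ - y))`. Summed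
  -- over `i`, these terms account for the `-#{i | g i = j₀}` in the weight.
  have h₁ (i : Fin r) : (W * p - W * ∏ i', 1 / (Function.update x i x₀ i' - y (g i'))) /
      (x₀ - x i) = W * p * (1 / (x₀ - y (g i))) := by
    have h₂ : ∏ i', 1 / (Function.update x i x₀ i' - y (g i')) =
        p * ((x i - y (g i)) / (x₀ - y (g i))) := by
      rw [hp, ← Finset.mul_prod_erase _ _ (Finset.mem_univ i),
        ← Finset.mul_prod_erase _ (fun i => 1 / (x i - y (g i))) (Finset.mem_univ i),
        Function.update_self, Finset.prod_congr rfl fun i' hi' => by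
          rw [Function.update_of_ne (Finset.ne_of_mem_erase hi')]]
      have := sub_ne_zero.2 (hy i (g i))
      field_simp
    rw [h₂]
    have := sub_ne_zero.2 (hx i)
    have := sub_ne_zero.2 (hy₀ (g i))
    field_simp
    ring
  rw [Finset.sum_congr rfl fun i _ => h₁ i]
  have h₃ : ∑ i, W * p * (1 / (x₀ - y (g i))) =
      ∑ j, W * p * (Finset.card {i | g i = j} * (1 / (x₀ - y j))) := by
    simp only [← Finset.mul_sum, Finset.card_filter, Nat.cast_sum, Finset.sum_mul]
    rw [Finset.sum_comm]
    simp
  rw [h₃, Finset.sum_mul, ← Finset.sum_sub_distrib]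
  refine Finset.sum_congr rfl fun j _ => ?_
  ring

/-- The weighted permanent depends on the columns only through the row sums. -/
lemma weightedCauchyPermanent_congr {J K : Type*} [Fintype J] [DecidableEq J] [Fintype K]
    [DecidableEq K] (α y : J → ℂ) (β z : K → ℂ) {r : ℕ} (x : Fin r → ℂ)
    (hx : Function.Injective x) (hy : ∀ i j, x i ≠ y j) (hz : ∀ i k, x i ≠ z k)
    (h : ∀ i, ∑ j, α j / (x i - y j) = ∑ k, β k / (x i - z k)) :
    weightedCauchyPermanent α y x = weightedCauchyPermanent β z x := by
  induction r with
  | zero => simp [weightedCauchyPermanent]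
  | succ r ih =>
    obtain ⟨x₀, x, rfl⟩ : ∃ x₀ x', x = Fin.cons x₀ x' := ⟨x 0, Fin.tail x, by simp⟩
    rw [Fin.cons_injective_iff] at hx
    simp only [Fin.forall_fin_succ, Fin.cons_zero, Fin.cons_succ] at hy hz h
    have hne (i) : x₀ ≠ x i := fun e => hx.1 ⟨i, e.symm⟩
    rw [weightedCauchyPermanent_cons α y x₀ x hne hy.1 hy.2,
      weightedCauchyPermanent_cons β z x₀ x hne hz.1 hz.2, h.1, ih x hx.2 hy.2 hz.2 h.2]
    congr 1
    refine Finset.sum_congr rfl fun i _ => ?_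
    rw [ih (Function.update x i x₀)]
    · intro a b hab
      by_cases ha : a = i <;> by_cases hb : b = i
      · rw [ha, hb]
      · subst ha
        simp [Function.update_of_ne hb, hne] at hab
      · subst hb
        simp [Function.update_of_ne ha, (hne _).symm] at hab
      · rw [Function.update_of_ne ha, Function.update_of_ne hb] at hab
        exact hx.2 hab
    all_goals
      intro i'
      rcases eq_or_ne i' i with rfl | hi
      · simp [hy.1, hz.1, h.1]
      · simp [Function.update_of_ne hi, hy.2, hz.2, h.2]

/-- The falling factorial of `1` vanishes from order 2 on, so only injective assignments survive. -/
lemma rectPermanent_eq_weightedCauchyPermanent {ι J : Type*} [Fintype ι] [Fintype J]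
    [DecidableEq J] (x : ι → ℂ) (y : J → ℂ) {r : ℕ} (e : Fin r ≃ ι) :
    rectPermanent (Matrix.of fun i j => 1 / (x i - y j)) =
      weightedCauchyPermanent (fun _ => 1) y (x ∘ e) := by
  classical
  have hw (g : Fin r → J) :
      ∏ j, (descPochhammer ℂ (Finset.card {i | g i = j})).eval (1 : ℂ) =
        if Function.Injective g then 1 else 0 := by
    split_ifs with hg
    · refine Finset.prod_eq_one fun j _ => ?_
      have : Finset.card {i | g i = j} ≤ 1 :=
        Finset.card_le_one.2 fun a ha b hb => hg (by simp_all)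
      interval_cases Finset.card {i | g i = j} <;> simp
    · obtain ⟨a, b, hab, hne⟩ := Function.not_injective_iff.1 hg
      refine Finset.prod_eq_zero (Finset.mem_univ (g a)) ?_
      have : 1 < Finset.card {i | g i = g a} :=
        Finset.one_lt_card.2 ⟨a, by simp, b, by simp [hab], hne⟩
      exact_mod_cast descPochhammer_eval_coe_nat_of_lt (R := ℂ) this
  unfold rectPermanent weightedCauchyPermanent
  simp only [hw, ite_mul, one_mul, zero_mul]
  rw [← Finset.sum_filter, ← Finset.sum_subtype_eq_sum_filter, Finset.subtype_univ]
  refine Fintype.sum_equiv (((Equiv.embeddingCongr e (Equiv.refl J)).symm).trans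
    (Equiv.subtypeInjectiveEquivEmbedding (Fin r) J).symm) _ _ fun f => ?_
  rw [← e.prod_comp]
  rfl

/-- The power of `X` records how many rows use the column `true`, and the weight depends only on
that number. -/
lemma weightedCauchyPermanent_bool {r : ℕ} (α y : Bool → ℂ) (x : Fin r → ℂ) :
    weightedCauchyPermanent α y x =
      ∑ k ∈ Finset.range (r + 1),
        (∏ i, (C (1 / (x i - y false)) + C (1 / (x i - y true)) * X)).coeff k *
          ((descPochhammer ℂ (r - k)).eval (α false) * (descPochhammer ℂ k).eval (α true)) := by
  have hprod : ∏ i, (C (1 / (x i - y false)) + C (1 / (x i - y true)) * X) =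
      ∑ g : Fin r → Bool,
        C (∏ i, 1 / (x i - y (g i))) * X ^ Finset.card {i | g i = true} := by
    have h (i : Fin r) : C (1 / (x i - y false)) + C (1 / (x i - y true)) * X =
        ∑ b : Bool, C (1 / (x i - y b)) * X ^ (if b = true then 1 else 0) := by
      simp [add_comm]
    simp only [h]
    rw [Finset.prod_univ_sum, Fintype.piFinset_univ]
    refine Finset.sum_congr rfl fun g _ => ?_
    rw [Finset.prod_mul_distrib, Finset.prod_pow_eq_pow_sum, Finset.card_filter, map_prod]
  simp only [hprod, finsetSum_coeff, Finset.sum_mul, coeff_C_mul_X_pow]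
  rw [Finset.sum_comm, weightedCauchyPermanent]
  refine Finset.sum_congr rfl fun g _ => ?_
  have hcard : Finset.card {i | g i = true} + Finset.card {i | g i = false} = r := by
    have := Finset.card_filter_add_card_filter_not (s := Finset.univ) (fun i => g i = true)
    simpa using this
  have hle : Finset.card {i | g i = true} < r + 1 := by omega
  simp only [ite_mul, zero_mul]
  rw [Finset.sum_ite_eq' (Finset.range (r + 1)), if_pos (Finset.mem_range.2 hle),
    Fintype.prod_bool, show r - Finset.card {i | g i = true} = Finset.card {i | g i = false} by omega]
  ring

lemma descPochhammer_eval_add (r s : ℂ) (k : ℕ) :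
    (descPochhammer ℂ k).eval (r + s) = ∑ i ∈ Finset.range (k + 1),
      (k.choose i : ℂ) * ((descPochhammer ℂ i).eval r * (descPochhammer ℂ (k - i)).eval s) := by
  have h (j : ℕ) (z : ℂ) : (descPochhammer ℤ j).smeval z = (descPochhammer ℂ j).eval z := by
    rw [← aeval_eq_smeval, ← descPochhammer_map (Int.castRingHom ℂ), eval_map, aeval_def]
    rfl
  have := Ring.descPochhammer_smeval_add k (Commute.all r s)
  simp only [h] at this
  rw [this, Finset.Nat.sum_antidiagonal_eq_sum_range_succ_mk]

lemma descPochhammer_eval_neg_two (k : ℕ) :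
    (descPochhammer ℂ k).eval (-2) = (k + 1) * (descPochhammer ℂ k).eval (-1) := by
  induction k with
  | zero => simp
  | succ k ih =>
    rw [descPochhammer_succ_eval, descPochhammer_succ_eval, ih]
    push_cast
    ring

/-- The factor `k + 1` relating `-2` to `-1` is absorbed by the binomial coefficient;
Chu–Vandermonde for `-1 + c` remains. -/
lemma sum_choose_mul_descPochhammer_eval (r : ℕ) (c : ℂ) :
    ∑ k ∈ Finset.range (r + 1), ((r + 1).choose (k + 1) : ℂ) *
      ((descPochhammer ℂ (r - k)).eval c * (descPochhammer ℂ k).eval (-2)) =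
        (r + 1) * (descPochhammer ℂ r).eval (c - 1) := by
  rw [show c - 1 = -1 + c by ring, descPochhammer_eval_add, Finset.mul_sum]
  refine Finset.sum_congr rfl fun k _ => ?_
  have h : ((r : ℂ) + 1) * r.choose k = (r + 1).choose (k + 1) * (k + 1) := by
    exact_mod_cast Nat.add_one_mul_choose_eq r k
  rw [descPochhammer_eval_neg_two]
  linear_combination (-(descPochhammer ℂ (r - k)).eval c * (descPochhammer ℂ k).eval (-1)) * h

/-- The weighted permanent with rows the nontrivial `(r + 1)`-st roots of unity and with two
columns, at `0` with multiplicity `c` and at `1` with multiplicity `-2`. -/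
lemma weightedCauchyPermanent_bool_of_prod_X_sub_C {r : ℕ} (x : Fin r → ℂ) (c : ℂ)
    (hx : ∏ i, (X - C (x i)) = ∑ k ∈ Finset.range (r + 1), X ^ k) :
    weightedCauchyPermanent (fun b => cond b (-2) c) (fun b => cond b 1 0) x =
      (-1) ^ r * (descPochhammer ℂ r).eval (c - 1) := by
  have heval (z : ℂ) : ∏ i, (z - x i) = ∑ k ∈ Finset.range (r + 1), z ^ k := by
    simpa [eval_prod, eval_finsetSum] using congrArg (eval z) hx
  -- The geometric sum is its own reciprocal polynomial.
  have hrev (z : ℂ) : ∏ i, (1 - z * x i) = ∑ k ∈ Finset.range (r + 1), z ^ k := by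
    rcases eq_or_ne z 0 with rfl | hz
    · simp [Finset.sum_range_succ']
    · have h : ∏ i, (1 - z * x i) = ∏ i, z * (z⁻¹ - x i) :=
        Finset.prod_congr rfl fun i _ => by field_simp
      rw [h, Finset.prod_mul_distrib, heval, Finset.prod_const, Finset.card_univ, Fintype.card_fin,
        Finset.mul_sum, ← Finset.sum_range_reflect]
      refine Finset.sum_congr rfl fun k hk => ?_
      have hk : k ≤ r := by simpa [Nat.lt_succ_iff] using hk
      rw [show r + 1 - 1 - k = r - k by omega, inv_pow, ← div_eq_mul_inv, div_eq_iff (by positivity),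
        ← pow_add, Nat.add_sub_cancel' hk]
  have hone : ∏ i, (1 - x i) = r + 1 := by simpa using heval 1
  have hmul : ∏ i, x i = (-1) ^ r := by
    have h := heval 0
    simp only [zero_sub, Finset.prod_neg, Finset.sum_range_succ', Finset.card_univ,
      Fintype.card_fin] at h
    have h' : (-1 : ℂ) ^ r * (-1) ^ r = 1 := by rw [← mul_pow]; simp
    simp at h
    linear_combination (-1) ^ r * h - (∏ i, x i) * h'
  have hx0 (i) : x i ≠ 0 := by
    have : ∏ i, x i ≠ 0 := by rw [hmul]; simp
    exact Finset.prod_ne_zero_iff.1 this i (Finset.mem_univ i)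
  have hx1 (i) : 1 - x i ≠ 0 := by
    have : ∏ i, (1 - x i) ≠ 0 := by rw [hone]; exact_mod_cast r.succ_ne_zero
    exact Finset.prod_ne_zero_iff.1 this i (Finset.mem_univ i)
  -- Each factor is `(1 - (t + 1) * x i) / (x i * (1 - x i))`, so the product is a geometric sum in
  -- `t + 1` over a constant.
  have hpoly : ∏ i, (C (1 / (x i - 0)) + C (1 / (x i - 1)) * X) =
      C ((-1 : ℂ) ^ r / ((r : ℂ) + 1)) *
        ∑ k ∈ Finset.range (r + 1), (((r + 1).choose (k + 1) : ℕ) : ℂ[X]) * X ^ k := by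
    rw [← geom_sum_X_comp_X_add_one_eq_sum]
    refine Polynomial.funext fun t => ?_
    have h (i) : 1 / (x i - 0) + 1 / (x i - 1) * t = (1 - (t + 1) * x i) / (x i * (1 - x i)) := by
      have := hx0 i
      have := hx1 i
      have : x i - 1 ≠ 0 := fun e => hx1 i (by linear_combination -e)
      rw [sub_zero]
      field_simp
      ring
    simp only [eval_prod, eval_add, eval_mul, eval_C, eval_X, h, Finset.prod_div_distrib, hrev,
      Finset.prod_mul_distrib, hmul, hone, eval_comp, eval_finsetSum, eval_pow, eval_one]
    have h' : ((-1 : ℂ) ^ r)⁻¹ = (-1) ^ r := by rw [← inv_pow]; norm_num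
    rw [div_eq_mul_inv, mul_inv, h', div_eq_mul_inv]
    ring
  have hr : (r : ℂ) + 1 ≠ 0 := by exact_mod_cast r.succ_ne_zero
  rw [weightedCauchyPermanent_bool]
  simp only [cond_true, cond_false, hpoly]
  have hcoeff (k : ℕ) (hk : k ∈ Finset.range (r + 1)) : (C ((-1 : ℂ) ^ r / (r + 1)) *
      ∑ k ∈ Finset.range (r + 1), (((r + 1).choose (k + 1) : ℕ) : ℂ[X]) * X ^ k).coeff k =
        (-1) ^ r / (r + 1) * ((r + 1).choose (k + 1) : ℂ) := by
    simp only [coeff_C_mul, finsetSum_coeff, ← C_eq_natCast, coeff_X_pow]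
    simp [Finset.mem_range.1 hk]
  rw [Finset.sum_congr rfl fun k hk => by rw [hcoeff k hk, mul_assoc], ← Finset.mul_sum,
    sum_choose_mul_descPochhammer_eval]
  field_simp

lemma injective_coe_of_nodup {α : Type*} [DecidableEq α] {s : Multiset α} (hs : s.Nodup) :
    Function.Injective fun z : s => z.1 := by
  rintro ⟨a, k⟩ ⟨b, l⟩ (rfl : a = b)
  have := Multiset.nodup_iff_count_le_one.1 hs a
  have hkl : k = l := Fin.ext (by omega)
  rw [hkl]

lemma sum_add_mul_pow_mul_sub_one_sq (a z : ℂ) (N : ℕ) :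
    (∑ l ∈ Finset.range N, ((l : ℂ) + a) * z ^ l) * (z - 1) ^ 2 =
      (N + a - 1) * z ^ (N + 1) - (N + a) * z ^ N - (a - 1) * z + a := by
  induction N with
  | zero => simp
  | succ N ih =>
    rw [Finset.sum_range_succ, add_mul, ih]
    push_cast
    ring

/-- For `z ^ N = 1` the four-term identity collapses to `N * (z - 1)`. This also rules out common
zeros. -/
lemma sum_add_mul_mul_pow_mul_sub_one (a z : ℂ) (N : ℕ) (hz : z ^ N = 1) (hz1 : z ≠ 1) :
    (∑ l ∈ Finset.range N, ((l : ℂ) + a) * z ^ l) * (z - 1) = N := by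
  have := sum_add_mul_pow_mul_sub_one_sq a z N
  apply mul_right_cancel₀ (sub_ne_zero.2 hz1)
  linear_combination this + ((N + a - 1) * z - (N + a)) * hz

lemma eval_derivative_div_eval_sum_add_mul_pow (a z : ℂ) (N : ℕ) (hN : N ≠ 0) (hz : z ^ N = 1)
    (hz1 : z ≠ 1) :
    (derivative (∑ l ∈ Finset.range N, C ((l : ℂ) + a) * X ^ l)).eval z /
      (∑ l ∈ Finset.range N, C ((l : ℂ) + a) * X ^ l).eval z = (a + N) / z - 2 / (z - 1) := by
  set Q : ℂ[X] := ∑ l ∈ Finset.range N, C ((l : ℂ) + a) * X ^ l with hQ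
  have hmul : Q * (X - 1) ^ 2 =
      C (N + a - 1) * X ^ (N + 1) - C (N + a) * X ^ N - C (a - 1) * X + C a := by
    refine Polynomial.funext fun t => ?_
    simpa [hQ, eval_finsetSum] using sum_add_mul_pow_mul_sub_one_sq a t N
  have hz0 : z ≠ 0 := by rintro rfl; simp [hN] at hz
  have hz1' := sub_ne_zero.2 hz1
  have hev : Q.eval z * (z - 1) = N := by
    simpa [hQ, eval_finsetSum] using sum_add_mul_mul_pow_mul_sub_one a z N hz hz1
  have hNC : (N : ℂ) ≠ 0 := by exact_mod_cast hN
  have hQz : Q.eval z ≠ 0 := fun h => by simp [h] at hev; exact hNC hev.symm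
  have hpred : z ^ (N - 1) * z = 1 := by rw [← pow_succ, Nat.sub_add_cancel (by omega), hz]
  -- Differentiating `Q * (X - 1) ^ 2` at `z` gives `Q'(z)` in terms of the known `Q(z)`.
  have hder := congrArg (fun p => (derivative p).eval z) hmul
  simp only [derivative_mul, derivative_add, derivative_sub, derivative_pow, derivative_X,
    derivative_one, derivative_C, eval_add, eval_sub, eval_mul, eval_pow, eval_X, eval_one, eval_C,
    zero_mul, zero_add, Nat.add_sub_cancel, hz, sub_zero, eval_zero] at hder
  norm_num at hder
  rw [div_eq_iff hQz, div_sub_div _ _ hz0 hz1', div_mul_eq_mul_div,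
    eq_div_iff (mul_ne_zero hz0 hz1')]
  apply mul_right_cancel₀ hz1'
  linear_combination z * hder - ((a + N) * (z - 1)) * hev - (N + a) * N * hpred

theorem theorem38 (n m : ℕ) (hn : 2 ≤ n) (hm : 1 ≤ m) (a : ℂ) :
    (∀ x y : ℂ, (∑ k ∈ Finset.range n, (X : ℂ[X]) ^ k).IsRoot x →
        (∑ l ∈ Finset.range (m * n), C ((l : ℂ) + a) * X ^ l).IsRoot y → x ≠ y) ∧
      scottPER (∑ k ∈ Finset.range n, X ^ k)
          (∑ l ∈ Finset.range (m * n), C ((l : ℂ) + a) * X ^ l) =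
        (-1) ^ (n - 1) * (ascPochhammer ℂ (n - 1)).eval (a + ((m : ℂ) - 1) * (n : ℂ) + 1) := by
  obtain ⟨r, rfl⟩ : ∃ r, n = r + 1 := ⟨n - 1, by omega⟩
  set N := m * (r + 1) with hN
  have hN0 : N ≠ 0 := by positivity
  set P : ℂ[X] := ∑ k ∈ Finset.range (r + 1), X ^ k with hP
  set Q : ℂ[X] := ∑ l ∈ Finset.range N, C ((l : ℂ) + a) * X ^ l with hQ
  have hroot {z : ℂ} (hz : P.IsRoot z) : z ^ N = 1 ∧ z ≠ 1 := by
    have hs : ∑ k ∈ Finset.range (r + 1), z ^ k = 0 := by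
      simpa [hP, IsRoot, eval_finsetSum] using hz
    constructor
    · have := geom_sum_mul z (r + 1)
      rw [hs, zero_mul, eq_comm, sub_eq_zero] at this
      rw [hN, mul_comm, pow_mul, this, one_pow]
    · rintro rfl
      simp only [one_pow, Finset.sum_const, Finset.card_range, nsmul_eq_mul, mul_one] at hs
      exact absurd hs (by exact_mod_cast r.succ_ne_zero)
  have hQP {z : ℂ} (hz : P.IsRoot z) : Q.eval z ≠ 0 := by
    have := sum_add_mul_mul_pow_mul_sub_one a z N (hroot hz).1 (hroot hz).2
    intro h
    rw [show ∑ l ∈ Finset.range N, ((l : ℂ) + a) * z ^ l = Q.eval z by simp [hQ, eval_finsetSum], h,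
      zero_mul] at this
    exact hN0 (by exact_mod_cast this.symm)
  have hdisj : ∀ x y : ℂ, P.IsRoot x → Q.IsRoot y → x ≠ y := by
    rintro x _ hx hy rfl
    exact hQP hx hy
  refine ⟨hdisj, ?_⟩
  have hmonic : P.Monic := by
    simpa [hP] using monic_geom_sum_X (R := ℂ) r.succ_ne_zero
  have hmul : P * (X - C 1) = X ^ (r + 1) - C 1 := by
    simpa using geom_sum_mul (X : ℂ[X]) (r + 1)
  have hdeg : P.natDegree = r := by
    have h := congrArg natDegree hmul
    rw [natDegree_mul hmonic.ne_zero (X_sub_C_ne_zero 1), natDegree_X_sub_C,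
      natDegree_X_pow_sub_C] at h
    omega
  have hsplit : P.roots.card = r := by
    rw [← hdeg, ← (IsAlgClosed.splits P).natDegree_eq_card_roots]
  have hnodup : P.roots.Nodup := by
    have h : (X ^ (r + 1) - C 1 : ℂ[X]).Separable :=
      separable_X_pow_sub_C 1 (by exact_mod_cast r.succ_ne_zero) one_ne_zero
    rw [← hmul] at h
    exact nodup_roots h.of_mul_left
  let e : Fin r ≃ P.roots := (Fintype.equivFinOfCardEq (by rw [Multiset.card_coe, hsplit])).symm
  have hmem (i : Fin r) : P.IsRoot (e i).1 := isRoot_of_mem_roots Multiset.coe_mem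
  have hinj : Function.Injective fun i : Fin r => (e i).1 :=
    (injective_coe_of_nodup hnodup).comp e.injective
  have hprod : ∏ i, (X - C (e i).1) = P := by
    refine Eq.trans ?_ ((IsAlgClosed.splits P).eq_prod_roots_of_monic hmonic).symm
    rw [e.prod_comp fun z => (X - C z.1 : ℂ[X]), Finset.prod_eq_multiset_prod,
      Multiset.map_univ P.roots fun z => (X - C z : ℂ[X])]
  classical
  have hper : scottPER P Q = weightedCauchyPermanent (fun _ : Q.roots => 1) (fun z => z.1)
      (fun i => (e i).1) :=
    rectPermanent_eq_weightedCauchyPermanent (fun z : P.roots => z.1) (fun z : Q.roots => z.1) e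
  have hcols : weightedCauchyPermanent (fun _ : Q.roots => 1) (fun z => z.1) (fun i => (e i).1) =
      weightedCauchyPermanent (fun b => cond b (-2) (a + N)) (fun b => cond b 1 0)
        (fun i => (e i).1) := by
    apply weightedCauchyPermanent_congr _ _ _ _ _ hinj
    · exact fun i j => hdisj _ _ (hmem i) (isRoot_of_mem_roots Multiset.coe_mem)
    · rintro i (_ | _)
      · intro h
        have h1 := (hroot (hmem i)).1
        rw [h, cond_false, zero_pow hN0] at h1
        exact zero_ne_one h1
      · exact (hroot (hmem i)).2
    · intro i
      rw [Finset.sum_eq_multiset_sum, Multiset.map_univ Q.roots fun z => (1 : ℂ) / ((e i).1 - z),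
        ← (IsAlgClosed.splits Q).eval_derivative_div_eval_of_ne_zero (hQP (hmem i)),
        eval_derivative_div_eval_sum_add_mul_pow a _ N hN0 (hroot (hmem i)).1 (hroot (hmem i)).2]
      simp only [Fintype.sum_bool, cond_true, cond_false, sub_zero]
      ring
  rw [hper, hcols, weightedCauchyPermanent_bool_of_prod_X_sub_C _ _ hprod,
    descPochhammer_eval_eq_ascPochhammer, Nat.add_sub_cancel]
  -- Falling to rising factorial: the base is `a + N - 1 - r + 1`, with `N = m * (r + 1)`.
  congr 2
  rw [hN]
  push_cast
  ring
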